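/- Notation. Let $\omega=\{0,1,2,\dots\}$, and identify a set $A\subseteq\omega$ with its characteristic function, a point of $2^\omega$. A set $D\subseteq\omega$ is a \emph{coarse description} of $X\subseteq\omega$ if $\lim_{n\to\infty}\frac{|(D\triangle X)\cap\{0,\dots,n-1\}|}{n}=0$. Write $Y\leq_{\mathrm{nc}}X$ (nonuniform coarse reducibility) if every coarse description of $X$ computes a coarse description of $Y$. Write $Y\leq_{\mathrm{uc}}X$ (uniform coarse reducibility) if there is a single Turing functional $\Phi$ such that $\Phi^D$ is a coarse description of $Y$ for every coarse description $D$ of $X$. For $A\subseteq\omega$ let $\mathcal I(A)=\bigcup_{n\in A}[n!,(n+1)!)$ and let $\mathcal E(A)=\mathcal I(\mathcal H(A))$, where $\mathcal H(A)=\{\langle n,i\rangle : n\in A,\ i\in\omega\}$ and $\langle\cdot,\cdot\rangle$ is the standard computable pairing bijection $\omega^2\to\omega$. A set $X$ is \emph{$2$-random} if it is Martin-Löf random relative to the halting problem $\emptyset'$, that is, $X\notin\bigcap_n U_n$ for every sequence $(U_n)_{n\in\omega}$ of uniformly $\Sigma^{0}_1(\emptyset')$ classes in $2^\omega$ with $\mu(U_n)\leq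 2^{-n}$ for all $n$, where $\mu$ is the uniform measure. Corollary. If $X\subseteq\omega$ is $2$-random, then $\mathcal E(X)\leq_{\mathrm{nc}}\mathcal I(X)$ but $\mathcal E(X)\nleq_{\mathrm{uc}}\mathcal I(X)$. -/

import Mathlib

namespace CoarseReducibility

open Set Filter Topology MeasureTheory

/-! ### Turing functionals -/

/-- Programs for computations with an oracle: the usual schemes for partial recursive functions,
with one further basic instruction that queries the oracle. -/
inductive OracleCode : Type
  | zero : OracleCode
  | succ : OracleCode
  | left : OracleCode
  | right : OracleCode
  | oracle : OracleCode
  | pair : OracleCode → OracleCode → OracleCode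
  | comp : OracleCode → OracleCode → OracleCode
  | prec : OracleCode → OracleCode → OracleCode
  | rfind : OracleCode → OracleCode

/-- The partial function that a program computes from the oracle `g`. The clauses are those of
`Nat.RecursiveIn`, so the map `g ↦ c.eval g` is the Turing functional with program `c`. -/
def OracleCode.eval (g : ℕ →. ℕ) : OracleCode → ℕ →. ℕ
  | .zero => fun _ => Part.some 0
  | .succ => fun n => Part.some (n + 1)
  | .left => fun n => Part.some (Nat.unpair n).1
  | .right => fun n => Part.some (Nat.unpair n).2
  | .oracle => g
  | .pair c d => fun n => Nat.pair <$> c.eval g n <*> d.eval g n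
  | .comp c d => fun n => d.eval g n >>= c.eval g
  | .prec c d => fun p =>
      (Nat.unpair p).2.rec (c.eval g (Nat.unpair p).1) fun y IH => do
        let i ← IH
        d.eval g (Nat.pair (Nat.unpair p).1 (Nat.pair y i))
  | .rfind c => fun a => Nat.rfind fun n => (fun m => m = 0) <$> c.eval g (Nat.pair a n)

/-- What is computed from the oracle `g` by some program is exactly what is
Turing reducible to `g`. -/
theorem turingReducible_iff_exists_code (f g : ℕ →. ℕ) :
    TuringReducible f g ↔ ∃ c : OracleCode, c.eval g = f := by
  rw [TuringReducible, RecursiveIn.iff_nat]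
  constructor
  · intro h
    induction h with
    | zero => exact ⟨.zero, rfl⟩
    | succ => exact ⟨.succ, rfl⟩
    | left => exact ⟨.left, rfl⟩
    | right => exact ⟨.right, rfl⟩
    | oracle k hk => exact ⟨.oracle, (mem_singleton_iff.1 hk).symm⟩
    | pair _ _ ih₁ ih₂ =>
      obtain ⟨c, rfl⟩ := ih₁
      obtain ⟨d, rfl⟩ := ih₂
      exact ⟨.pair c d, rfl⟩
    | comp _ _ ih₁ ih₂ =>
      obtain ⟨c, rfl⟩ := ih₁
      obtain ⟨d, rfl⟩ := ih₂
      exact ⟨.comp c d, rfl⟩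
    | prec _ _ ih₁ ih₂ =>
      obtain ⟨c, rfl⟩ := ih₁
      obtain ⟨d, rfl⟩ := ih₂
      exact ⟨.prec c d, rfl⟩
    | rfind _ ih =>
      obtain ⟨c, rfl⟩ := ih
      exact ⟨.rfind c, rfl⟩
  · rintro ⟨c, rfl⟩
    induction c with
    | zero => exact .zero
    | succ => exact .succ
    | left => exact .left
    | right => exact .right
    | oracle => exact .oracle g rfl
    | pair c d ih₁ ih₂ => exact .pair ih₁ ih₂
    | comp c d ih₁ ih₂ => exact .comp ih₁ ih₂
    | prec c d ih₁ ih₂ => exact .prec ih₁ ih₂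
    | rfind c ih => exact .rfind ih

open Classical in
/-- The characteristic sequence of a set, as a point of Cantor space. -/
noncomputable def charSeq (A : Set ℕ) : ℕ → Bool := fun n => decide (n ∈ A)

/-- The characteristic function of a set, in the form in which it is used as an oracle
and as the output of a computation. -/
noncomputable def charFun (A : Set ℕ) : ℕ →. ℕ := fun n => Part.some (charSeq A n).toNat

/-! ### Coarse reducibilities -/

/-- `A` has density `d`: the fractions `|A ∩ {0, …, n - 1}| / n` converge to `d`. -/
def HasDensity (A : Set ℕ) (d : ℝ) : Prop :=
  Tendsto (fun n : ℕ => ((A ∩ Iio n).ncard : ℝ) / n) atTop (𝓝 d)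

/-- `D` is a coarse description of `X`. -/
def IsCoarseDescription (D X : Set ℕ) : Prop := HasDensity (symmDiff D X) 0

/-- `UniformlyCoarselyReducible Y X` is `Y ≤_uc X`: a single Turing functional sends every coarse
description `D` of `X` to (the characteristic function of) a coarse description of `Y`. -/
def UniformlyCoarselyReducible (Y X : Set ℕ) : Prop :=
  ∃ c : OracleCode, ∀ D : Set ℕ, IsCoarseDescription D X →
    ∃ Z : Set ℕ, c.eval (charFun D) = charFun Z ∧ IsCoarseDescription Z Y

/-- `NonuniformlyCoarselyReducible Y X` is `Y ≤_nc X`: every coarse description of `X` computes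
a coarse description of `Y`. -/
def NonuniformlyCoarselyReducible (Y X : Set ℕ) : Prop :=
  ∀ D : Set ℕ, IsCoarseDescription D X →
    ∃ Z : Set ℕ, TuringReducible (charFun Z) (charFun D) ∧ IsCoarseDescription Z Y

/-! ### The codings -/

/-- `𝓘(A)`, the union of the intervals `[n!, (n+1)!)` over `n ∈ A`. -/
def codeI (A : Set ℕ) : Set ℕ := ⋃ n ∈ A, Ico n.factorial (n + 1).factorial

/-- `𝓗(A)`, the set of all pairs `⟨n, i⟩` with `n ∈ A`. -/
def codeH (A : Set ℕ) : Set ℕ := {m | ∃ n ∈ A, ∃ i : ℕ, m = Nat.pair n i}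

/-- `𝓔(A) = 𝓘(𝓗(A))`. -/
def codeE (A : Set ℕ) : Set ℕ := codeI (codeH A)

/-! ### Algorithmic randomness -/

/-- The uniform (fair coin) measure on Cantor space. -/
noncomputable def uniformMeasure : Measure (ℕ → Bool) :=
  Measure.infinitePi fun _ : ℕ => (PMF.uniformOfFintype Bool).toMeasure

/-- The open subset of Cantor space generated by a set `S` of finite binary strings: the sequences
that have an initial segment in `S`. -/
def openClass (S : Set (List Bool)) : Set (ℕ → Bool) :=
  {Z | ∃ k : ℕ, (List.range k).map Z ∈ S}

/-- The predicate `p` is computably enumerable relative to the set `A`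
(compare `REPred`, the unrelativized notion). -/
def REPredIn {α : Type*} [Primcodable α] (A : Set ℕ) (p : α → Prop) : Prop :=
  RecursiveIn {charFun A} fun a => Part.assert (p a) fun _ => Part.some ()

/-- The classes generated by `W 0, W 1, …` form a Martin-Löf test relative to `A`: they are
uniformly `Σ⁰₁` relative to `A`, and the `n`-th one has measure at most `2⁻ⁿ`. -/
def IsMartinLofTest (A : Set ℕ) (W : ℕ → Set (List Bool)) : Prop :=
  REPredIn A (fun p : ℕ × List Bool => p.2 ∈ W p.1) ∧
    ∀ n : ℕ, uniformMeasure (openClass (W n)) ≤ (2⁻¹ : ENNReal) ^ n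

/-- `X` is `1`-random (Martin-Löf random) relative to `A`. -/
def IsOneRandomIn (A X : Set ℕ) : Prop :=
  ∀ W : ℕ → Set (List Bool), IsMartinLofTest A W → ∃ n : ℕ, charSeq X ∉ openClass (W n)

/-- `∅'`, the halting problem. -/
def haltingSet : Set ℕ := {e | ((Denumerable.ofNat Nat.Partrec.Code e).eval e).Dom}

/-- `X` is `2`-random, that is, `1`-random relative to `∅'`. -/
def IsTwoRandom (X : Set ℕ) : Prop := IsOneRandomIn haltingSet X

end CoarseReducibility

namespace CoarseReducibility

open Set Filter Topology MeasureTheory Encodable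

/-! The nonuniform half holds for every `X`. On `[n!, (n+1)!)`, a coarse description of `codeI X`
agrees with the bit `X n` at most points once `n` is large, so majority votes give `X` up to
finitely many errors. A finite table corrects these, and `codeE X` is computable from `X`. The table
depends on the description, hence the nonuniformity.

For the uniform half, suppose that the program `c` witnesses the reduction. Erasing the first `N`
bits of `X` changes `codeI X` only finitely, so from the erased code `c` must still produce a coarse
description of `codeE X`. There each bit `X m` is repeated on the blocks `⟨m, i⟩` for all `i`, so
the votes along row `m` converge to it. Thus the first `N` bits of `X` are predicted in the limit by
the remaining ones (`eventually_selfPredicting`).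

A sequence with this property is determined by its tail from `N` on
(`eq_of_eventually_selfPredicting`), so the class of such sequences has measure at most `2⁻ᴺ`
(`uniformMeasure_le_of_tail`). It has the form "for some `s`, a primitive recursive condition holds
at all stages `t ≥ s`", hence is a union over `s` of intersections of decreasing clopen classes. The
halting problem recognizes a stage at which such an intersection is approximated within a prescribed
error. With summable errors this yields a Martin-Löf test relative to `∅'`
(`isMartinLofTest_stableTest`) that captures `X`. -/

/-- The initial segment of length `t` of a point of Cantor space. -/
def initSeg (Z : ℕ → Bool) (t : ℕ) : List Bool := (List.range t).map Z

@[simp] theorem length_initSeg (Z : ℕ → Bool) (t : ℕ) : (initSeg Z t).length = t := by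
  simp [initSeg]

theorem initSeg_succ (Z : ℕ → Bool) (t : ℕ) : initSeg Z (t + 1) = initSeg Z t ++ [Z t] := by
  simp [initSeg, List.range_succ]

theorem getElem?_initSeg (Z : ℕ → Bool) (t n : ℕ) :
    (initSeg Z t)[n]? = if n < t then some (Z n) else none := by
  by_cases h : n < t
  · simp [initSeg, h]
  · simp [initSeg, h]

theorem take_initSeg (Z : ℕ → Bool) {s t : ℕ} (h : s ≤ t) :
    (initSeg Z t).take s = initSeg Z s := by
  apply List.ext_getElem?
  intro n
  rw [List.getElem?_take, getElem?_initSeg, getElem?_initSeg]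
  split_ifs <;> first | rfl | omega

/-! ### Computations from finite strings -/

/-- The approximation to `OracleCode.eval` in which the oracle is a finite string, whose length
also bounds the unbounded searches. -/
def OracleCode.evalStr (σ : List Bool) : OracleCode → ℕ → Option ℕ
  | .zero => fun _ => some 0
  | .succ => fun n => some (n + 1)
  | .left => fun n => some (Nat.unpair n).1
  | .right => fun n => some (Nat.unpair n).2
  | .oracle => fun n => σ[n]?.map Bool.toNat
  | .pair c d => fun n => (c.evalStr σ n).bind fun a => (d.evalStr σ n).map fun b => Nat.pair a b
  | .comp c d => fun n => (d.evalStr σ n).bind fun a => c.evalStr σ a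
  | .prec c d => fun p =>
      (Nat.unpair p).2.rec (c.evalStr σ (Nat.unpair p).1) fun y IH =>
        IH.bind fun i => d.evalStr σ (Nat.pair (Nat.unpair p).1 (Nat.pair y i))
  | .rfind c => fun a =>
      -- An undefined value counts as zero and stops the search; the check below then rejects it. If
      -- the search finds nothing, `findIdx` returns `σ.length`, which is checked as a candidate
      -- too.
      let n := (List.range σ.length).findIdx fun n => (c.evalStr σ (Nat.pair a n)).getD 0 == 0
      if c.evalStr σ (Nat.pair a n) = some 0 then some n else none

theorem OracleCode.primrec_evalStr (c : OracleCode) :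
    Primrec₂ fun (σ : List Bool) (n : ℕ) => c.evalStr σ n := by
  induction c with
  | zero => exact Primrec₂.const _
  | succ => exact (Primrec.option_some.comp (Primrec.succ.comp Primrec.snd)).to₂
  | left =>
    exact (Primrec.option_some.comp (Primrec.fst.comp (Primrec.unpair.comp Primrec.snd))).to₂
  | right =>
    exact (Primrec.option_some.comp (Primrec.snd.comp (Primrec.unpair.comp Primrec.snd))).to₂
  | oracle =>
    exact (Primrec.option_map (Primrec.list_getElem?.comp Primrec.fst Primrec.snd)
      ((Primrec.dom_bool Bool.toNat).comp Primrec.snd).to₂).to₂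
  | pair c d ihc ihd =>
    have h : Primrec₂ fun (p : List Bool × ℕ) (a : ℕ) =>
        (d.evalStr p.1 p.2).map fun b => Nat.pair a b :=
      Primrec.option_map (ihd.comp (Primrec.fst.comp Primrec.fst) (Primrec.snd.comp Primrec.fst))
        (Primrec₂.natPair.comp (Primrec.snd.comp Primrec.fst) Primrec.snd).to₂
    exact (Primrec.option_bind (ihc.comp Primrec.fst Primrec.snd) h).to₂
  | comp c d ihc ihd =>
    have h : Primrec₂ fun (p : List Bool × ℕ) (a : ℕ) => c.evalStr p.1 a :=
      ihc.comp (Primrec.fst.comp Primrec.fst) Primrec.snd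
    exact (Primrec.option_bind (ihd.comp Primrec.fst Primrec.snd) h).to₂
  | prec c d ihc ihd =>
    have hu : Primrec fun p : List Bool × ℕ => p.2.unpair := Primrec.unpair.comp Primrec.snd
    have hd : Primrec₂ fun (q : (List Bool × ℕ) × (ℕ × Option ℕ)) (i : ℕ) =>
        d.evalStr q.1.1 (Nat.pair q.1.2.unpair.1 (Nat.pair q.2.1 i)) :=
      ihd.comp (Primrec.fst.comp (Primrec.fst.comp Primrec.fst)) <|
        Primrec₂.natPair.comp (Primrec.fst.comp (hu.comp (Primrec.fst.comp Primrec.fst))) <|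
          Primrec₂.natPair.comp (Primrec.fst.comp (Primrec.snd.comp Primrec.fst)) Primrec.snd
    have h : Primrec₂ fun (p : List Bool × ℕ) (z : ℕ × Option ℕ) =>
        z.2.bind fun i => d.evalStr p.1 (Nat.pair p.2.unpair.1 (Nat.pair z.1 i)) :=
      Primrec.option_bind (Primrec.snd.comp Primrec.snd) hd
    exact (Primrec.nat_rec' (Primrec.snd.comp hu)
      (ihc.comp Primrec.fst (Primrec.fst.comp hu)) h).to₂
  | rfind c ih =>
    have hc : Primrec₂ fun (p : List Bool × ℕ) (n : ℕ) => c.evalStr p.1 (Nat.pair p.2 n) :=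
      ih.comp (Primrec.fst.comp Primrec.fst)
        (Primrec₂.natPair.comp (Primrec.snd.comp Primrec.fst) Primrec.snd)
    have hz : Primrec₂ fun (p : List Bool × ℕ) (n : ℕ) =>
        (c.evalStr p.1 (Nat.pair p.2 n)).getD 0 == 0 :=
      Primrec.beq.comp (Primrec.option_getD.comp hc (Primrec.const 0)) (Primrec.const 0)
    have hn : Primrec fun p : List Bool × ℕ => (List.range p.1.length).findIdx fun n =>
        (c.evalStr p.1 (Nat.pair p.2 n)).getD 0 == 0 :=
      Primrec.list_findIdx (Primrec.list_range.comp (Primrec.list_length.comp Primrec.fst)) hz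
    have h : Primrec fun p : List Bool × ℕ => c.evalStr p.1 (Nat.pair p.2
        ((List.range p.1.length).findIdx fun n =>
          (c.evalStr p.1 (Nat.pair p.2 n)).getD 0 == 0)) :=
      hc.comp Primrec.id hn
    exact (Primrec.ite (Primrec.eq.comp h (Primrec.const (some 0)))
      (Primrec.option_some.comp hn) (Primrec.const none)).to₂

theorem OracleCode.evalStr_rfind_eq_some {σ : List Bool} {c : OracleCode} {a n : ℕ} :
    (OracleCode.rfind c).evalStr σ a = some n ↔ n ≤ σ.length ∧
      c.evalStr σ (Nat.pair a n) = some 0 ∧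
        ∀ k < n, ∃ v, v ≠ 0 ∧ c.evalStr σ (Nat.pair a k) = some v := by
  have key : ∀ k : ℕ, (((c.evalStr σ (Nat.pair a k)).getD 0 == 0) = false) ↔
      ∃ v, v ≠ 0 ∧ c.evalStr σ (Nat.pair a k) = some v := by
    intro k
    cases c.evalStr σ (Nat.pair a k) <;> simp
  simp only [OracleCode.evalStr]
  set p : ℕ → Bool := fun n => (c.evalStr σ (Nat.pair a n)).getD 0 == 0 with hp
  constructor
  · intro h
    split_ifs at h with h0
    have hn := Option.some.inj h
    rw [hn] at h0
    refine ⟨?_, h0, fun k hk => ?_⟩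
    · rw [← hn]
      exact List.findIdx_le_length.trans (by simp)
    · rw [← key]
      have := List.not_of_lt_findIdx (p := p) (xs := List.range σ.length) (hn ▸ hk)
      simpa [hp] using this
  · rintro ⟨hle, h0, hlt⟩
    have hn : (List.range σ.length).findIdx p = n := by
      rcases hle.lt_or_eq with h | h
      · rw [List.findIdx_eq (by simpa using h)]
        refine ⟨by simp [hp, h0], fun k hk => ?_⟩
        simpa [hp] using (key k).2 (hlt k hk)
      · have hlen : (List.range σ.length).findIdx p = (List.range σ.length).length :=
          List.findIdx_eq_length.2 fun k hk => (key k).2 (hlt k (h ▸ List.mem_range.1 hk))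
        rw [hlen, List.length_range, h]
    rw [hn, if_pos h0]

/-- A longer oracle string only adds defined values. A zero found by `rfind` remains the least one
because all earlier values are already defined and nonzero. -/
theorem OracleCode.evalStr_mono (Z : ℕ → Bool) (c : OracleCode) {s t x y : ℕ} (hst : s ≤ t)
    (h : c.evalStr (initSeg Z s) x = some y) : c.evalStr (initSeg Z t) x = some y := by
  induction c generalizing x y with
  | zero | succ | left | right => exact h
  | oracle =>
    simp only [OracleCode.evalStr, getElem?_initSeg] at h ⊢
    split_ifs at h with hx
    · rw [if_pos (hx.trans_le hst)]
      exact h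
    · simp at h
  | pair c d ihc ihd =>
    simp only [OracleCode.evalStr, Option.bind_eq_some_iff, Option.map_eq_some_iff] at h ⊢
    obtain ⟨a, ha, b, hb, hab⟩ := h
    exact ⟨a, ihc ha, b, ihd hb, hab⟩
  | comp c d ihc ihd =>
    simp only [OracleCode.evalStr, Option.bind_eq_some_iff] at h ⊢
    obtain ⟨a, ha, hy⟩ := h
    exact ⟨a, ihd ha, ihc hy⟩
  | prec c d ihc ihd =>
    simp only [OracleCode.evalStr] at h ⊢
    generalize (Nat.unpair x).2 = k at h ⊢
    induction k generalizing y with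
    | zero => exact ihc h
    | succ k ih =>
      simp only [Option.bind_eq_some_iff] at h ⊢
      obtain ⟨i, hi, hy⟩ := h
      exact ⟨i, ih hi, ihd hy⟩
  | rfind c ih =>
    rw [OracleCode.evalStr_rfind_eq_some] at h ⊢
    obtain ⟨hle, h0, hlt⟩ := h
    rw [length_initSeg] at hle ⊢
    exact ⟨hle.trans hst, ih h0, fun k hk => (hlt k hk).imp fun v hv => ⟨hv.1, ih hv.2⟩⟩

theorem OracleCode.evalStr_sound (Z : ℕ → Bool) (c : OracleCode) {t x y : ℕ}
    (h : c.evalStr (initSeg Z t) x = some y) :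
    y ∈ c.eval (fun n => Part.some (Z n).toNat) x := by
  induction c generalizing x y with
  | zero | succ | left | right => simpa [OracleCode.evalStr, OracleCode.eval, eq_comm] using h
  | oracle =>
    simp only [OracleCode.evalStr, getElem?_initSeg] at h
    split_ifs at h with hx
    · simpa [OracleCode.eval, eq_comm] using h
    · simp at h
  | pair c d ihc ihd =>
    simp only [OracleCode.evalStr, Option.bind_eq_some_iff, Option.map_eq_some_iff] at h
    obtain ⟨a, ha, b, hb, hab⟩ := h
    simp only [OracleCode.eval, Seq.seq, Part.map_eq_map, Part.bind_map, Part.mem_bind_iff,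
      Part.mem_map_iff]
    exact ⟨a, ihc ha, b, ihd hb, hab⟩
  | comp c d ihc ihd =>
    simp only [OracleCode.evalStr, Option.bind_eq_some_iff] at h
    obtain ⟨a, ha, hy⟩ := h
    exact Part.mem_bind_iff.2 ⟨a, ihd ha, ihc hy⟩
  | prec c d ihc ihd =>
    simp only [OracleCode.evalStr, OracleCode.eval] at h ⊢
    generalize (Nat.unpair x).2 = k at h ⊢
    induction k generalizing y with
    | zero => exact ihc h
    | succ k ih =>
      simp only [Option.bind_eq_some_iff] at h
      obtain ⟨i, hi, hy⟩ := h
      exact Part.mem_bind_iff.2 ⟨i, ih hi, ihd hy⟩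
  | rfind c ih =>
    rw [OracleCode.evalStr_rfind_eq_some] at h
    obtain ⟨-, h0, hlt⟩ := h
    refine Nat.mem_rfind.2 ⟨?_, fun {k} hk => ?_⟩
    · exact (Part.mem_map_iff _).2 ⟨0, ih h0, by simp⟩
    · obtain ⟨v, hv, hkv⟩ := hlt k hk
      exact (Part.mem_map_iff _).2 ⟨v, ih hkv, by simpa using hv⟩

theorem OracleCode.exists_evalStr (Z : ℕ → Bool) (c : OracleCode) {x y : ℕ}
    (h : y ∈ c.eval (fun n => Part.some (Z n).toNat) x) :
    ∃ t, c.evalStr (initSeg Z t) x = some y := by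
  induction c generalizing x y with
  | zero | succ | left | right =>
    exact ⟨0, by simpa [OracleCode.evalStr, OracleCode.eval, eq_comm] using h⟩
  | oracle =>
    refine ⟨x + 1, ?_⟩
    have hy : y = (Z x).toNat := Part.mem_some_iff.1 h
    simp only [OracleCode.evalStr, getElem?_initSeg, if_pos (Nat.lt_succ_self x), hy,
      Option.map_some]
  | pair c d ihc ihd =>
    simp only [OracleCode.eval, Seq.seq, Part.map_eq_map, Part.bind_map, Part.mem_bind_iff,
      Part.mem_map_iff] at h
    obtain ⟨a, ha, b, hb, hab⟩ := h
    obtain ⟨s, hs⟩ := ihc ha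
    obtain ⟨t, ht⟩ := ihd hb
    refine ⟨max s t, ?_⟩
    simp only [OracleCode.evalStr, Option.bind_eq_some_iff, Option.map_eq_some_iff]
    exact ⟨a, c.evalStr_mono Z (le_max_left _ _) hs, b, d.evalStr_mono Z (le_max_right _ _) ht,
      hab⟩
  | comp c d ihc ihd =>
    obtain ⟨a, ha, hy⟩ := Part.mem_bind_iff.1 h
    obtain ⟨s, hs⟩ := ihd ha
    obtain ⟨t, ht⟩ := ihc hy
    refine ⟨max s t, ?_⟩
    simp only [OracleCode.evalStr, Option.bind_eq_some_iff]
    exact ⟨a, d.evalStr_mono Z (le_max_left _ _) hs, c.evalStr_mono Z (le_max_right _ _) ht⟩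
  | prec c d ihc ihd =>
    simp only [OracleCode.evalStr, OracleCode.eval] at h ⊢
    generalize (Nat.unpair x).2 = k at h ⊢
    -- The recursion depth `k` is now independent of `x`; monotonicity comes from evaluating at
    -- `Nat.pair x.unpair.1 k`.
    have mono : ∀ (k : ℕ) {s t y : ℕ}, s ≤ t →
        (Nat.rec (c.evalStr (initSeg Z s) x.unpair.1) (fun y IH => IH.bind fun i =>
          d.evalStr (initSeg Z s) (Nat.pair x.unpair.1 (Nat.pair y i))) k : Option ℕ) = some y →
        (Nat.rec (c.evalStr (initSeg Z t) x.unpair.1) (fun y IH => IH.bind fun i =>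
          d.evalStr (initSeg Z t) (Nat.pair x.unpair.1 (Nat.pair y i))) k : Option ℕ) = some y := by
      intro k s t y hst hs
      have := (OracleCode.prec c d).evalStr_mono Z (x := Nat.pair x.unpair.1 k) (y := y) hst
      simp only [OracleCode.evalStr, Nat.unpair_pair] at this
      exact this hs
    induction k generalizing y with
    | zero => exact ihc h
    | succ k ih =>
      obtain ⟨i, hi, hy⟩ := Part.mem_bind_iff.1 h
      obtain ⟨s, hs⟩ := ih hi
      obtain ⟨t, ht⟩ := ihd hy
      refine ⟨max s t, ?_⟩
      simp only [Option.bind_eq_some_iff]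
      exact ⟨i, mono k (le_max_left _ _) hs, d.evalStr_mono Z (le_max_right _ _) ht⟩
  | rfind c ih =>
    obtain ⟨h0, hlt⟩ := Nat.mem_rfind.1 h
    obtain ⟨v, hv, hv0⟩ := (Part.mem_map_iff _).1 h0
    obtain rfl : v = 0 := by simpa using hv0
    obtain ⟨t₀, ht₀⟩ := ih hv
    have : ∀ k, ∃ t, k < y → ∃ v, v ≠ 0 ∧ c.evalStr (initSeg Z t) (Nat.pair x k) = some v := by
      intro k
      by_cases hk : k < y
      · obtain ⟨v, hv, hv0⟩ := (Part.mem_map_iff _).1 (hlt hk)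
        obtain ⟨t, ht⟩ := ih hv
        exact ⟨t, fun _ => ⟨v, by simpa using hv0, ht⟩⟩
      · exact ⟨0, fun h => absurd h hk⟩
    choose t ht using this
    -- The length must reach `y` as well, because it bounds the search.
    refine ⟨max (max y t₀) ((Finset.range y).sup t), ?_⟩
    rw [OracleCode.evalStr_rfind_eq_some, length_initSeg]
    refine ⟨(le_max_left _ _).trans (le_max_left _ _),
      c.evalStr_mono Z ((le_max_right _ _).trans (le_max_left _ _)) ht₀, fun k hk => ?_⟩
    obtain ⟨v, hv, hkv⟩ := ht k hk
    exact ⟨v, hv, c.evalStr_mono Z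
      ((Finset.le_sup (f := t) (Finset.mem_range.2 hk)).trans (le_max_right _ _)) hkv⟩

/-! ### Computability relative to a set -/

theorem recursiveIn_initSeg (A : Set ℕ) :
    Nat.RecursiveIn {charFun A} fun n => Part.some (encode (initSeg (charSeq A) n)) := by
  have hstep : Nat.Primrec fun p : ℕ =>
      encode (((decode p.unpair.1 : Option (List Bool)).getD []) ++ [p.unpair.2 == 1]) := by
    rw [← Primrec.nat_iff]
    refine Primrec.encode.comp (Primrec.list_concat.comp (Primrec.option_getD.comp
      (Primrec.decode.comp (Primrec.fst.comp Primrec.unpair)) (Primrec.const []))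
      (Primrec.beq.comp (Primrec.snd.comp Primrec.unpair) (Primrec.const 1)))
  have hstep' := hstep.recursiveIn (O := {charFun A})
  have horacle : Nat.RecursiveIn {charFun A} (charFun A) := .oracle _ rfl
  -- Primitive recursion with dummy parameter `0`: the step receives `⟨0, ⟨y, i⟩⟩` and appends the
  -- oracle's answer at `y` to the string coded by `i`.
  have h := (Nat.RecursiveIn.prec (O := {charFun A})
    ((Nat.Primrec.const (encode ([] : List Bool))).recursiveIn)
    (hstep'.comp ((Nat.RecursiveIn.right.comp Nat.RecursiveIn.right).pair
      (horacle.comp (Nat.RecursiveIn.left.comp Nat.RecursiveIn.right))))).comp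
    (Nat.Primrec.pair (Nat.Primrec.const 0) Nat.Primrec.id).recursiveIn
  refine h.of_eq fun n => ?_
  have hA : charFun A = fun n => Part.some (charSeq A n).toNat := rfl
  simp only [Part.coe_some, Part.bind_eq_bind, Part.bind_some, Nat.unpair_pair, id]
  induction n with
  | zero => rfl
  | succ n ih =>
    dsimp only at ih ⊢
    rw [ih, Part.bind_some]
    simp only [Seq.seq, Part.bind_eq_bind, Part.map_eq_map, Part.map_some, Part.bind_some, hA,
      Nat.unpair_pair, encodek, Option.getD_some, initSeg_succ]
    cases charSeq A n <;> rfl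

/-- For computations whose use has a primitive recursive bound `u`: the oracle is consulted once,
for an initial segment. -/
theorem turingReducible_of_primrec {A : Set ℕ} {F : ℕ → List Bool → ℕ} (hF : Primrec₂ F)
    {u : ℕ → ℕ} (hu : Primrec u) :
    TuringReducible (fun x => Part.some (F x (initSeg (charSeq A) (u x)))) (charFun A) := by
  refine RecursiveIn.iff_nat.2 ?_
  have hF' : Nat.Primrec fun p : ℕ =>
      F p.unpair.1 ((decode p.unpair.2 : Option (List Bool)).getD []) := by
    rw [← Primrec.nat_iff]
    exact hF.comp (Primrec.fst.comp Primrec.unpair) (Primrec.option_getD.comp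
      (Primrec.decode.comp (Primrec.snd.comp Primrec.unpair)) (Primrec.const []))
  have h := (hF'.recursiveIn (O := {charFun A})).comp
    ((Nat.Primrec.id.recursiveIn (O := {charFun A})).pair
      ((recursiveIn_initSeg A).comp (Primrec.nat_iff.1 hu).recursiveIn))
  refine h.of_eq fun n => ?_
  simp [Seq.seq]

/-- The s-m-n theorem: `e n` codes the search for `m` with `n` built in by `curry`. -/
theorem exists_primrec_mem_haltingSet {p : ℕ × ℕ → Prop} (hp : PrimrecPred p) :
    ∃ e : ℕ → ℕ, Primrec e ∧ ∀ n, e n ∈ haltingSet ↔ ∃ m, p (n, m) := by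
  classical
  have hpart : Nat.Partrec fun x : ℕ =>
      Nat.rfind fun m => Part.some (decide (p (x.unpair.1, m))) := by
    refine Partrec.nat_iff.1 ?_
    have hdec : Primrec fun q => decide (p q) := primrecPred_iff_primrec_decide.1 hp
    refine Partrec.rfind (p := fun (x : ℕ) m => Part.some (decide (p (x.unpair.1, m)))) ?_
    exact (hdec.comp (Primrec.pair (Primrec.fst.comp (Primrec.unpair.comp Primrec.fst))
      Primrec.snd)).to_comp.partrec
  obtain ⟨c, hc⟩ := Nat.Partrec.Code.exists_code.1 hpart
  refine ⟨fun n => encode (Nat.Partrec.Code.curry c n),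
    Primrec.encode.comp (Nat.Partrec.Code.primrec₂_curry.comp (Primrec.const c) Primrec.id),
    fun n => ?_⟩
  simp only [haltingSet, mem_ofPred_eq, Denumerable.ofNat_encode, Nat.Partrec.Code.eval_curry, hc,
    Nat.unpair_pair]
  refine Nat.rfind_dom.trans ?_
  constructor
  · rintro ⟨m, hm, -⟩
    exact ⟨m, by simpa using hm⟩
  · rintro ⟨m, hm⟩
    exact ⟨m, by simpa using hm, fun _ => trivial⟩

/-- A `Σ⁰₂` predicate is computably enumerable in the halting problem. -/
theorem rePredIn_haltingSet {α : Type*} [Primcodable α] {p : (α × ℕ) × ℕ → Prop}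
    (hp : PrimrecPred p) :
    REPredIn haltingSet fun a : α => ∃ k, ∀ m, p ((a, k), m) := by
  -- The refutation of the inner universal statement. It holds vacuously when the code of `a` does
  -- not decode, so that on such inputs every `e ⟨n, k⟩` halts and the search for `k` diverges.
  have hq : PrimrecPred fun x : ℕ × ℕ =>
      ∀ a : α, (decode x.1.unpair.1 : Option α) = some a → ¬ p ((a, x.1.unpair.2), x.2) := by
    classical
    rw [primrecPred_iff_primrec_decide] at hp ⊢
    have h1 : Primrec fun x : ℕ × ℕ => x.1.unpair := Primrec.unpair.comp Primrec.fst
    refine (Primrec.option_casesOn (Primrec.decode.comp (Primrec.fst.comp h1))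
      (Primrec.const true) (g := fun x a => !decide (p ((a, x.1.unpair.2), x.2))) ?_).of_eq ?_
    · exact (Primrec.not.comp (hp.comp (Primrec.pair (Primrec.pair Primrec.snd
        (Primrec.snd.comp (h1.comp Primrec.fst))) (Primrec.snd.comp Primrec.fst)))).to₂
    · rintro ⟨x, m⟩
      dsimp only
      cases (decode x.unpair.1 : Option α) <;> simp
  obtain ⟨e, he, hmem⟩ := exists_primrec_mem_haltingSet hq
  have horacle : Nat.RecursiveIn {charFun haltingSet} (charFun haltingSet) := .oracle _ rfl
  -- `rfind` stops where the oracle answers `0`, that is, at the first `k` for which no refutation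
  -- exists.
  have h := ((Nat.Primrec.const 0).recursiveIn (O := {charFun haltingSet})).comp
    (Nat.RecursiveIn.rfind (horacle.comp (Primrec.nat_iff.1 he).recursiveIn))
  classical
  have hval : ∀ x, ((fun m => decide (m = 0)) <$> ((Part.some (e x) : Part ℕ) >>=
      charFun haltingSet) : Part Bool) = Part.some (decide (e x ∉ haltingSet)) := by
    intro x
    refine (congrArg (Part.map _) (Part.bind_some (e x) (charFun haltingSet))).trans ?_
    change Part.map _ (Part.some (charSeq haltingSet (e x)).toNat) = _
    rw [Part.map_some, charSeq]
    by_cases hx : e x ∈ haltingSet <;> simp [hx]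
  refine h.of_eq fun n => Part.ext fun y => ?_
  have hmem' : ∀ (a : α) (k : ℕ), (decode n : Option α) = some a →
      (e (Nat.pair n k) ∉ haltingSet ↔ ∀ m, p ((a, k), m)) := by
    intro a k ha
    rw [hmem]
    push Not
    simp [ha]
  have hdom : (Nat.rfind fun k => (fun m => decide (m = 0)) <$>
      ((Part.some (e (Nat.pair n k)) : Part ℕ) >>= charFun haltingSet)).Dom ↔
      ∃ k, e (Nat.pair n k) ∉ haltingSet := by
    simp only [hval]
    refine Nat.rfind_dom.trans ⟨?_, ?_⟩
    · rintro ⟨k, hk, -⟩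
      exact ⟨k, by simpa using hk⟩
    · rintro ⟨k, hk⟩
      exact ⟨k, by simpa using hk, fun _ => trivial⟩
  have hl : (∃ k, k ∈ (Nat.rfind fun k => (fun m => decide (m = 0)) <$>
      ((Part.some (e (Nat.pair n k)) : Part ℕ) >>= charFun haltingSet))) ↔
      ∃ k, e (Nat.pair n k) ∉ haltingSet := by
    rw [← hdom, Part.dom_iff_mem]
  refine Part.mem_bind_iff.trans ?_
  trans (∃ k, e (Nat.pair n k) ∉ haltingSet) ∧ y = 0
  · rw [← hl]
    constructor
    · rintro ⟨k, hk, hy⟩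
      exact ⟨⟨k, hk⟩, Part.mem_some_iff.1 hy⟩
    · rintro ⟨⟨k, hk⟩, hy⟩
      exact ⟨k, hk, Part.mem_some_iff.2 hy⟩
  · rcases ha : (decode n : Option α) with _ | a
    · have : ¬ ∃ k, e (Nat.pair n k) ∉ haltingSet := by
        rintro ⟨k, hk⟩
        exact hk ((hmem _).2 ⟨0, by simp [ha]⟩)
      simp [this]
    · simp only [hmem' a _ ha]
      rw [Part.coe_some, Part.bind_some, Part.mem_map_iff]
      simp only [Part.mem_assert_iff, Part.mem_some_iff, exists_prop]
      exact ⟨fun h => ⟨(), ⟨h.1, trivial⟩, h.2.symm⟩, fun ⟨_, h⟩ => ⟨h.1.1, h.2.symm⟩⟩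

/-! ### The uniform measure -/

instance : IsProbabilityMeasure uniformMeasure := by
  unfold uniformMeasure
  infer_instance

theorem setOf_initSeg_eq (σ : List Bool) : {Z : ℕ → Bool | initSeg Z σ.length = σ} =
    Set.pi (Finset.range σ.length) fun i => {b | some b = σ[i]?} := by
  ext Z
  simp only [mem_ofPred_eq, Set.mem_pi, Finset.coe_range, mem_Iio]
  constructor
  · intro h i hi
    rw [← h, getElem?_initSeg, if_pos hi]
  · intro h
    refine List.ext_getElem? fun i => ?_
    rw [getElem?_initSeg]
    split_ifs with hi
    · exact h i hi
    · exact (List.getElem?_eq_none (by omega)).symm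

theorem measurableSet_initSeg_eq (t : ℕ) (σ : List Bool) :
    MeasurableSet {Z : ℕ → Bool | initSeg Z t = σ} := by
  by_cases h : σ.length = t
  · rw [← h, setOf_initSeg_eq]
    exact MeasurableSet.pi (Finset.countable_toSet _) fun i _ => MeasurableSet.of_discrete
  · convert MeasurableSet.empty
    refine Set.eq_empty_of_forall_notMem fun Z hZ => h ?_
    rw [← (hZ : initSeg Z t = σ), length_initSeg]

/-- The list of all binary strings of length `t`. -/
def strings : ℕ → List (List Bool)
  | 0 => [[]]
  | t + 1 => (strings t).flatMap fun σ => [σ ++ [false], σ ++ [true]]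

theorem mem_strings {t : ℕ} {σ : List Bool} : σ ∈ strings t ↔ σ.length = t := by
  induction t generalizing σ with
  | zero => simp [strings]
  | succ t ih =>
    simp only [strings, List.mem_flatMap, ih]
    constructor
    · rintro ⟨τ, rfl, h⟩
      rcases (by simpa using h : σ = τ ++ [false] ∨ σ = τ ++ [true]) with rfl | rfl <;> simp
    · intro h
      have hne : σ ≠ [] := by
        rintro rfl
        simp at h
      refine ⟨σ.dropLast, by simp [h], ?_⟩
      have := List.dropLast_append_getLast hne
      cases hb : σ.getLast hne <;> rw [hb] at this <;> simp [this]

theorem nodup_strings (t : ℕ) : (strings t).Nodup := by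
  induction t with
  | zero => simp [strings]
  | succ t ih =>
    refine List.nodup_flatMap.2 ⟨fun σ _ => by simp, ih.imp ?_⟩
    intro σ τ hne
    simp only [Function.onFun, List.disjoint_left]
    intro ρ h₁ h₂
    simp only [List.mem_cons, List.not_mem_nil, or_false] at h₁ h₂
    apply hne
    rcases h₁ with rfl | rfl <;> rcases h₂ with h | h <;> simp at h <;> exact h

theorem uniformMeasure_initSeg_eq (σ : List Bool) :
    uniformMeasure {Z | initSeg Z σ.length = σ} = (2⁻¹ : ENNReal) ^ σ.length := by
  rw [setOf_initSeg_eq, uniformMeasure, Measure.infinitePi_pi _ (fun i _ => MeasurableSet.of_discrete)]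
  rw [Finset.prod_congr rfl (g := fun _ => (2⁻¹ : ENNReal)), Finset.prod_const,
    Finset.card_range]
  intro i hi
  have hs : {b | some b = σ[i]?} = {σ[i]'(Finset.mem_range.1 hi)} := by
    ext b
    simp [List.getElem?_eq_getElem (Finset.mem_range.1 hi)]
  rw [hs, PMF.toMeasure_apply_singleton _ _ (MeasurableSet.singleton _)]
  simp

theorem measurableSet_initSeg (p : List Bool → Prop) (t : ℕ) :
    MeasurableSet {Z : ℕ → Bool | p (initSeg Z t)} := by
  have : {Z : ℕ → Bool | p (initSeg Z t)} = ⋃ σ ∈ {σ | p σ}, {Z | initSeg Z t = σ} := by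
    ext Z
    simp
  rw [this]
  exact MeasurableSet.biUnion (Set.to_countable _) fun σ _ => measurableSet_initSeg_eq t σ

theorem uniformMeasure_initSeg (p : List Bool → Prop) [DecidablePred p] (t : ℕ) :
    uniformMeasure {Z | p (initSeg Z t)} =
      ((strings t).filter (p ·)).length * (2⁻¹ : ENNReal) ^ t := by
  have : {Z : ℕ → Bool | p (initSeg Z t)} =
      ⋃ σ ∈ ((strings t).filter (p ·)).toFinset, {Z | initSeg Z t = σ} := by
    ext Z
    simp [mem_strings]
  rw [this, measure_biUnion_finset]
  · rw [Finset.sum_congr rfl (g := fun _ => (2⁻¹ : ENNReal) ^ t), Finset.sum_const,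
      List.toFinset_card_of_nodup ((nodup_strings t).filter _), nsmul_eq_mul]
    intro σ hσ
    obtain rfl : σ.length = t := mem_strings.1 (List.mem_filter.1 (List.mem_toFinset.1 hσ)).1
    exact uniformMeasure_initSeg_eq σ
  · intro σ _ τ _ hne
    refine Set.disjoint_left.2 fun Z h₁ h₂ => hne ?_
    exact (Eq.symm h₁).trans h₂
  · exact fun σ _ => measurableSet_initSeg_eq t σ

/-- Adding a fixed sequence modulo `2` preserves the uniform measure. -/
theorem measurePreserving_xor (e : ℕ → Bool) :
    MeasurePreserving (fun (Z : ℕ → Bool) n => xor (e n) (Z n)) uniformMeasure uniformMeasure := by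
  have hm : Measurable fun (Z : ℕ → Bool) n => xor (e n) (Z n) :=
    measurable_pi_lambda _ fun n => (Measurable.of_discrete (f := fun b => xor (e n) b)).comp
      (measurable_pi_apply n)
  refine ⟨hm, ?_⟩
  unfold uniformMeasure
  rw [Measure.infinitePi_map_pi _ (fun n => Measurable.of_discrete (f := fun b => xor (e n) b))]
  congr 1
  funext n
  refine Measure.ext_of_singleton fun b => ?_
  rw [Measure.map_apply Measurable.of_discrete (MeasurableSet.singleton _)]
  have : (fun c => xor (e n) c) ⁻¹' {b} = {xor (e n) b} := by
    ext c
    cases e n <;> cases b <;> cases c <;> simp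
  rw [this, PMF.toMeasure_apply_singleton _ _ (MeasurableSet.singleton _),
    PMF.toMeasure_apply_singleton _ _ (MeasurableSet.singleton _)]
  simp

/-- A class whose members are determined by their tails from `N` on has measure at most `2⁻ᴺ`. -/
theorem uniformMeasure_le_of_tail {P : Set (ℕ → Bool)} (hP : MeasurableSet P) (N : ℕ)
    (h : ∀ Z ∈ P, ∀ Z' ∈ P, (∀ n, N ≤ n → Z n = Z' n) → Z = Z') :
    uniformMeasure P ≤ (2⁻¹ : ENNReal) ^ N := by
  -- The `2 ^ N` translates of `P` by sequences supported below `N` have equal measure, and they are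
  -- disjoint because a common point would give two members of `P` with the same tail.
  let e : (Fin N → Bool) → ℕ → Bool := fun a n => if hn : n < N then a ⟨n, hn⟩ else false
  have hpre : ∀ a, uniformMeasure ((fun (Z : ℕ → Bool) n => xor (e a n) (Z n)) ⁻¹' P) =
      uniformMeasure P := fun a =>
    (measurePreserving_xor (e a)).measure_preimage hP.nullMeasurableSet
  have hdisj : Pairwise (Function.onFun Disjoint fun a =>
      (fun (Z : ℕ → Bool) n => xor (e a n) (Z n)) ⁻¹' P) := by
    intro a b hab
    refine Set.disjoint_left.2 fun Z ha hb => hab ?_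
    have := h _ ha _ hb fun n hn => by simp [e, hn.not_gt]
    funext i
    have := congrFun this i
    simpa [e] using this
  have hsum := measure_iUnion hdisj
    (fun a => (measurePreserving_xor (e a)).measurable hP) (μ := uniformMeasure)
  simp only [hpre, tsum_fintype, Finset.sum_const, Finset.card_univ, Fintype.card_fun,
    Fintype.card_bool, Fintype.card_fin, nsmul_eq_mul] at hsum
  have hle : ((2 ^ N : ℕ) : ENNReal) * uniformMeasure P ≤ 1 := hsum ▸ prob_le_one
  rw [← ENNReal.inv_pow]
  rw [mul_comm] at hle
  simpa using ENNReal.le_inv_iff_mul_le.2 (by simpa using hle)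

/-! ### Classes of sequences that eventually satisfy a primitive recursive condition -/

theorem primrecRel_forall_lt {β : Type*} [Primcodable β] {R : ℕ → β → Prop}
    (hR : PrimrecRel R) : PrimrecRel fun n b => ∀ x < n, R x b :=
  (hR.forall_mem_list.comp (Primrec.list_range.comp Primrec.fst) Primrec.snd).of_eq
    fun q => by simp

theorem primrecRel_exists_lt {β : Type*} [Primcodable β] {R : ℕ → β → Prop}
    (hR : PrimrecRel R) : PrimrecRel fun n b => ∃ x < n, R x b :=
  (hR.exists_mem_list.comp (Primrec.list_range.comp Primrec.fst) Primrec.snd).of_eq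
    fun q => by simp

/-- All initial segments of `σ` of length at least `s` satisfy `R N`. -/
def Stable (R : ℕ → List Bool → Prop) (N s : ℕ) (σ : List Bool) : Prop :=
  ∀ t < σ.length + 1, s ≤ t → R N (σ.take t)

open Classical in
/-- The number of strings of length `t` that satisfy `Stable R N s`. -/
noncomputable def stableCount (R : ℕ → List Bool → Prop) (N s t : ℕ) : ℕ :=
  ((strings t).filter (Stable R N s ·)).length

theorem primrec_strings : Primrec strings := by
  have hc : ∀ b : Bool, Primrec fun q : (ℕ × List (List Bool)) × List Bool => q.2 ++ [b] :=
    fun b => Primrec.list_concat.comp Primrec.snd (Primrec.const b)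
  have h : Primrec₂ fun (_ : ℕ) (L : List (List Bool)) =>
      L.flatMap fun σ => [σ ++ [false], σ ++ [true]] :=
    Primrec.list_flatMap Primrec.snd
      (Primrec.list_cons.comp (hc false) (Primrec.list_cons.comp (hc true) (Primrec.const []))).to₂
  refine (Primrec.nat_rec₁ [[]] h).of_eq fun n => ?_
  induction n with
  | zero => rfl
  | succ n ih =>
    change List.flatMap _ _ = _
    rw [ih]
    rfl

theorem primrecPred_stable {R : ℕ → List Bool → Prop} (hR : PrimrecRel R) :
    PrimrecPred fun q : (ℕ × ℕ) × List Bool => Stable R q.1.1 q.1.2 q.2 := by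
  have h : PrimrecRel fun (t : ℕ) (q : (ℕ × ℕ) × List Bool) =>
      ¬ q.1.2 ≤ t ∨ R q.1.1 (q.2.take t) := by
    refine PrimrecPred.or (PrimrecPred.not (Primrec.nat_le.comp ?_ Primrec.fst))
      (hR.comp ?_ ?_)
    · exact Primrec.snd.comp (Primrec.fst.comp Primrec.snd)
    · exact Primrec.fst.comp (Primrec.fst.comp Primrec.snd)
    · exact Primrec.list_take.comp Primrec.fst (Primrec.snd.comp Primrec.snd)
  refine ((primrecRel_forall_lt h).comp (Primrec.succ.comp (Primrec.list_length.comp Primrec.snd))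
    Primrec.id).of_eq fun q => ?_
  simp only [Stable, id, ← imp_iff_not_or, Nat.succ_eq_add_one]

theorem primrec_stableCount {R : ℕ → List Bool → Prop} (hR : PrimrecRel R) :
    Primrec fun q : (ℕ × ℕ) × ℕ => stableCount R q.1.1 q.1.2 q.2 := by
  classical
  have hg : Primrec₂ fun (q : (ℕ × ℕ) × ℕ) (σ : List Bool) =>
      if Stable R q.1.1 q.1.2 σ then some σ else none :=
    Primrec.ite ((primrecPred_stable hR).comp (Primrec.pair (Primrec.fst.comp Primrec.fst)
      Primrec.snd)) (Primrec.option_some.comp Primrec.snd) (Primrec.const none)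
  refine (Primrec.list_length.comp
    (Primrec.listFilterMap (primrec_strings.comp Primrec.snd) hg)).of_eq fun q => ?_
  rw [stableCount, ← List.filterMap_eq_filter]
  congr 2
  funext σ
  simp [Option.guard]

theorem primrec_nat_pow : Primrec₂ fun a b : ℕ => a ^ b :=
  Primrec₂.unpaired'.1 Nat.Primrec.pow

/-- From length `t` to length `t + m`, the class generated by `Stable R N s` loses measure
at most `2 ^ -(N + s + 1)`. -/
def SmallLoss (R : ℕ → List Bool → Prop) (N s t m : ℕ) : Prop :=
  stableCount R N s t * 2 ^ (m + (N + s + 1)) ≤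
    stableCount R N s (t + m) * 2 ^ (N + s + 1) + 2 ^ (t + m)

theorem primrecPred_smallLoss {R : ℕ → List Bool → Prop} (hR : PrimrecRel R) :
    PrimrecPred fun q : ((ℕ × ℕ) × ℕ) × ℕ => SmallLoss R q.1.1.1 q.1.1.2 q.1.2 q.2 := by
  have hN : Primrec fun q : ((ℕ × ℕ) × ℕ) × ℕ => q.1.1.1 :=
    Primrec.fst.comp (Primrec.fst.comp Primrec.fst)
  have hs : Primrec fun q : ((ℕ × ℕ) × ℕ) × ℕ => q.1.1.2 :=
    Primrec.snd.comp (Primrec.fst.comp Primrec.fst)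
  have ht : Primrec fun q : ((ℕ × ℕ) × ℕ) × ℕ => q.1.2 := Primrec.snd.comp Primrec.fst
  have hm : Primrec fun q : ((ℕ × ℕ) × ℕ) × ℕ => q.2 := Primrec.snd
  have hk : Primrec fun q : ((ℕ × ℕ) × ℕ) × ℕ => q.1.1.1 + q.1.1.2 + 1 :=
    Primrec.succ.comp (Primrec.nat_add.comp hN hs)
  have htm : Primrec fun q : ((ℕ × ℕ) × ℕ) × ℕ => q.1.2 + q.2 := Primrec.nat_add.comp ht hm
  have h2 : Primrec fun _ : ((ℕ × ℕ) × ℕ) × ℕ => 2 := Primrec.const 2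
  refine Primrec.nat_le.comp (Primrec.nat_mul.comp ((primrec_stableCount hR).comp Primrec.fst)
    (primrec_nat_pow.comp h2 (Primrec.nat_add.comp hm hk))) ?_
  exact Primrec.nat_add.comp (Primrec.nat_mul.comp ((primrec_stableCount hR).comp
    (Primrec.pair (Primrec.pair hN hs) htm)) (primrec_nat_pow.comp h2 hk))
      (primrec_nat_pow.comp h2 htm)

/-- The class of sequences generated by the strings of length `t` that satisfy `Stable R N s`. -/
def stableClass (R : ℕ → List Bool → Prop) (N s t : ℕ) : Set (ℕ → Bool) :=
  {Z | Stable R N s (initSeg Z t)}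

theorem mem_stableClass {R : ℕ → List Bool → Prop} {N s t : ℕ} {Z : ℕ → Bool} :
    Z ∈ stableClass R N s t ↔ ∀ u ≤ t, s ≤ u → R N (initSeg Z u) := by
  simp only [stableClass, Stable, mem_ofPred_eq, length_initSeg, Nat.lt_succ_iff]
  refine forall₂_congr fun u hu => ?_
  rw [take_initSeg Z hu]

theorem antitone_stableClass (R : ℕ → List Bool → Prop) (N s : ℕ) :
    Antitone (stableClass R N s) := fun _ _ hle _ hZ =>
  mem_stableClass.2 fun u hu => mem_stableClass.1 hZ u (hu.trans hle)

theorem mem_iInter_stableClass {R : ℕ → List Bool → Prop} {N s : ℕ} {Z : ℕ → Bool} :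
    Z ∈ ⋂ t, stableClass R N s t ↔ ∀ t, s ≤ t → R N (initSeg Z t) := by
  simp only [mem_iInter, mem_stableClass]
  exact ⟨fun h t => h t t le_rfl, fun h _ u _ => h u⟩

theorem measurableSet_stableClass (R : ℕ → List Bool → Prop) (N s t : ℕ) :
    MeasurableSet (stableClass R N s t) :=
  measurableSet_initSeg (Stable R N s) t

/-- Multiplying the measure inequality by `2 ^ (t + m + (N + s + 1))` clears denominators and leaves
a comparison of string counts, which is primitive recursive. -/
theorem smallLoss_iff {R : ℕ → List Bool → Prop} {N s t m : ℕ} :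
    SmallLoss R N s t m ↔ uniformMeasure (stableClass R N s t) ≤
      uniformMeasure (stableClass R N s (t + m)) + (2⁻¹ : ENNReal) ^ (N + s + 1) := by
  classical
  have hcount : ∀ t, uniformMeasure (stableClass R N s t) =
      stableCount R N s t * (2⁻¹ : ENNReal) ^ t := fun t => by
    rw [stableCount, stableClass, uniformMeasure_initSeg]
  have hpow : ∀ a b : ℕ, (2⁻¹ : ENNReal) ^ a * 2 ^ (a + b) = 2 ^ b := fun a b => by
    rw [pow_add, ← mul_assoc, ← mul_pow, ENNReal.inv_mul_cancel (by simp) (by simp), one_pow,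
      one_mul]
  rw [hcount, hcount, SmallLoss]
  generalize stableCount R N s t = c
  generalize stableCount R N s (t + m) = d
  generalize N + s + 1 = k
  rw [← ENNReal.mul_le_mul_iff_left (c := 2 ^ (t + m + k)) (by simp) (by simp), add_mul,
    mul_assoc, mul_assoc, hpow (t + m) k, add_assoc t m k, hpow t (m + k),
    show t + (m + k) = k + (t + m) by omega, hpow k (t + m)]
  exact_mod_cast Iff.rfl

theorem tendsto_stableClass (R : ℕ → List Bool → Prop) (N s : ℕ) :
    Tendsto (fun t => uniformMeasure (stableClass R N s t)) atTop
      (𝓝 (uniformMeasure (⋂ t, stableClass R N s t))) :=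
  tendsto_measure_iInter_atTop
    (fun t => (measurableSet_stableClass R N s t).nullMeasurableSet)
    (antitone_stableClass R N s) ⟨0, measure_ne_top _ _⟩

/-- The measures decrease to that of the intersection, so some stage is already close enough to the
limit, hence to all later stages. -/
theorem exists_smallLoss (R : ℕ → List Bool → Prop) (N s : ℕ) :
    ∃ t, ∀ m, SmallLoss R N s t m := by
  have hlt : uniformMeasure (⋂ t, stableClass R N s t) <
      uniformMeasure (⋂ t, stableClass R N s t) + (2⁻¹ : ENNReal) ^ (N + s + 1) :=
    ENNReal.lt_add_right (measure_ne_top _ _) (by simp)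
  obtain ⟨t, ht⟩ := ((tendsto_stableClass R N s).eventually (gt_mem_nhds hlt)).exists
  refine ⟨t, fun m => smallLoss_iff.2 (ht.le.trans ?_)⟩
  gcongr
  exact iInter_subset _ _

/-- The classes decrease in `t`, so all admissible stages contribute only what the least one does;
its excess over the intersection is bounded by letting `m` tend to infinity. -/
theorem uniformMeasure_smallLoss_diff_le (R : ℕ → List Bool → Prop) (N s : ℕ) :
    uniformMeasure ({Z | ∃ t, (∀ m, SmallLoss R N s t m) ∧ Z ∈ stableClass R N s t} \
      ⋂ t, stableClass R N s t) ≤ (2⁻¹ : ENNReal) ^ (N + s + 1) := by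
  classical
  have hex := exists_smallLoss R N s
  have hle : uniformMeasure (stableClass R N s (Nat.find hex)) ≤
      uniformMeasure (⋂ t, stableClass R N s t) + (2⁻¹ : ENNReal) ^ (N + s + 1) := by
    refine ge_of_tendsto' (((tendsto_stableClass R N s).comp
      (tendsto_add_atTop_nat (Nat.find hex))).add_const _) fun m => ?_
    rw [Function.comp_apply, add_comm m]
    exact smallLoss_iff.1 (Nat.find_spec hex m)
  calc _ ≤ uniformMeasure (stableClass R N s (Nat.find hex) \ ⋂ t, stableClass R N s t) := by
        refine measure_mono (Set.sdiff_subset_sdiff_left ?_)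
        rintro Z ⟨t, ht, hZ⟩
        exact antitone_stableClass R N s (Nat.find_le ht) hZ
    _ = uniformMeasure (stableClass R N s (Nat.find hex)) -
          uniformMeasure (⋂ t, stableClass R N s t) :=
        measure_sdiff (iInter_subset _ _)
          (MeasurableSet.iInter fun t => measurableSet_stableClass R N s t).nullMeasurableSet
          (measure_ne_top _ _)
    _ ≤ _ := tsub_le_iff_left.2 hle

/-- The strings that generate an open class containing all the sequences that eventually satisfy
`R (N + 1)`, and not much more. -/
def stableTest (R : ℕ → List Bool → Prop) (N : ℕ) : Set (List Bool) :=
  {σ | ∃ s, ∀ m, Stable R (N + 1) s σ ∧ SmallLoss R (N + 1) s σ.length m}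

theorem mem_openClass_stableTest {R : ℕ → List Bool → Prop} {N : ℕ} {Z : ℕ → Bool} :
    Z ∈ openClass (stableTest R N) ↔ ∃ s t, (∀ m, SmallLoss R (N + 1) s t m) ∧
      Z ∈ stableClass R (N + 1) s t := by
  have : Z ∈ openClass (stableTest R N) ↔ ∃ t s, ∀ m, Stable R (N + 1) s (initSeg Z t) ∧
      SmallLoss R (N + 1) s (initSeg Z t).length m := Iff.rfl
  rw [this, exists_comm]
  simp only [length_initSeg, forall_and, forall_const, stableClass, mem_ofPred_eq]
  exact exists₂_congr fun _ _ => and_comm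

theorem isMartinLofTest_stableTest {R : ℕ → List Bool → Prop} (hR : PrimrecRel R)
    (htail : ∀ (N : ℕ) (Z Z' : ℕ → Bool), (∀ n, N ≤ n → Z n = Z' n) →
      (∃ s, ∀ t, s ≤ t → R N (initSeg Z t)) → (∃ s, ∀ t, s ≤ t → R N (initSeg Z' t)) → Z = Z') :
    IsMartinLofTest haltingSet (stableTest R) := by
  constructor
  -- `Stable` does not involve `m`; it stands under the quantifier so that the test has the form `∃
  -- s, ∀ m` of a primitive recursive condition.
  · refine rePredIn_haltingSet (p := fun q : ((ℕ × List Bool) × ℕ) × ℕ =>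
      Stable R (q.1.1.1 + 1) q.1.2 q.1.1.2 ∧
        SmallLoss R (q.1.1.1 + 1) q.1.2 q.1.1.2.length q.2) ?_
    have hN : Primrec fun q : ((ℕ × List Bool) × ℕ) × ℕ => q.1.1.1 + 1 :=
      Primrec.succ.comp (Primrec.fst.comp (Primrec.fst.comp Primrec.fst))
    have hs : Primrec fun q : ((ℕ × List Bool) × ℕ) × ℕ => q.1.2 := Primrec.snd.comp Primrec.fst
    have hσ : Primrec fun q : ((ℕ × List Bool) × ℕ) × ℕ => q.1.1.2 :=
      Primrec.snd.comp (Primrec.fst.comp Primrec.fst)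
    exact ((primrecPred_stable hR).comp (Primrec.pair (Primrec.pair hN hs) hσ)).and
      ((primrecPred_smallLoss hR).comp (Primrec.pair (Primrec.pair (Primrec.pair hN hs)
        (Primrec.list_length.comp hσ)) Primrec.snd))
  · intro N
    have hP : uniformMeasure (⋃ s, ⋂ t, stableClass R (N + 1) s t) ≤
        (2⁻¹ : ENNReal) ^ (N + 1) := by
      refine uniformMeasure_le_of_tail (MeasurableSet.iUnion fun s => MeasurableSet.iInter fun t =>
        measurableSet_stableClass R (N + 1) s t) _ fun Z hZ Z' hZ' h => htail (N + 1) Z Z' h ?_ ?_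
      · exact (mem_iUnion.1 hZ).imp fun s hs => mem_iInter_stableClass.1 hs
      · exact (mem_iUnion.1 hZ').imp fun s hs => mem_iInter_stableClass.1 hs
    have hgeom : ∑' s : ℕ, (2⁻¹ : ENNReal) ^ (N + 1 + s + 1) = (2⁻¹ : ENNReal) ^ (N + 1) := by
      have : ∀ s : ℕ, (2⁻¹ : ENNReal) ^ (N + 1 + s + 1) = 2⁻¹ ^ (N + 2) * 2⁻¹ ^ s := fun s => by
        rw [← pow_add]
        congr 1
        omega
      simp only [this]
      rw [ENNReal.tsum_mul_left, ENNReal.tsum_geometric, ENNReal.one_sub_inv_two, inv_inv,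
        pow_succ _ (N + 1), mul_assoc, ENNReal.inv_mul_cancel (by simp) (by simp), mul_one]
    -- The shift to `N + 1` splits `2⁻ᴺ` into halves: one for the sequences that eventually satisfy
    -- the condition, one for the total excess over all `s`.
    calc uniformMeasure (openClass (stableTest R N))
        ≤ uniformMeasure ((⋃ s, ⋂ t, stableClass R (N + 1) s t) ∪
            ⋃ s, ({Z | ∃ t, (∀ m, SmallLoss R (N + 1) s t m) ∧ Z ∈ stableClass R (N + 1) s t} \
              ⋂ t, stableClass R (N + 1) s t)) := by
          refine measure_mono fun Z hZ => ?_
          obtain ⟨s, h⟩ := mem_openClass_stableTest.1 hZ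
          by_cases hs : Z ∈ ⋂ t, stableClass R (N + 1) s t
          · exact Or.inl (mem_iUnion.2 ⟨s, hs⟩)
          · exact Or.inr (mem_iUnion.2 ⟨s, h, hs⟩)
      _ ≤ (2⁻¹ : ENNReal) ^ (N + 1) + ∑' s : ℕ, (2⁻¹ : ENNReal) ^ (N + 1 + s + 1) := by
          refine (measure_union_le _ _).trans (add_le_add hP ((measure_iUnion_le _).trans ?_))
          exact ENNReal.tsum_le_tsum fun s => uniformMeasure_smallLoss_diff_le R (N + 1) s
      _ = (2⁻¹ : ENNReal) ^ N := by
          rw [hgeom, pow_succ, ← mul_add, ENNReal.inv_two_add_inv_two, mul_one]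

/-- If for each `N` a sequence eventually satisfies a primitive recursive condition `R N`, where
among the sequences with a given tail from `N` on there is at most one that does, then
the sequence is not `2`-random. -/
theorem not_isTwoRandom_of_eventually {R : ℕ → List Bool → Prop} (hR : PrimrecRel R)
    (htail : ∀ (N : ℕ) (Z Z' : ℕ → Bool), (∀ n, N ≤ n → Z n = Z' n) →
      (∃ s, ∀ t, s ≤ t → R N (initSeg Z t)) → (∃ s, ∀ t, s ≤ t → R N (initSeg Z' t)) → Z = Z')
    {X : Set ℕ} (hX : ∀ N, ∃ s, ∀ t, s ≤ t → R N (initSeg (charSeq X) t)) :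
    ¬ IsTwoRandom X := by
  intro h
  obtain ⟨N, hN⟩ := h _ (isMartinLofTest_stableTest hR htail)
  refine hN (mem_openClass_stableTest.2 ?_)
  obtain ⟨s, hs⟩ := hX (N + 1)
  obtain ⟨t, ht⟩ := exists_smallLoss R (N + 1) s
  exact ⟨s, t, ht, mem_stableClass.2 fun u _ hu => hs u hu⟩

open scoped Nat

/-! ### Majorities on the intervals `[n!, (n+1)!)` -/

open Classical in
/-- More than half of the elements of `[n!, (n+1)!)` satisfy `p`. -/
def Majority (p : ℕ → Prop) (n : ℕ) : Prop :=
  (n + 1)! < n ! + 2 * ((Finset.Ico n ! (n + 1)!).filter p).card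

theorem Majority.mono {p q : ℕ → Prop} {n : ℕ} (hp : Majority p n)
    (h : ∀ x < (n + 1)!, p x → q x) : Majority q n := by
  classical
  refine hp.trans_le (Nat.add_le_add_left (Nat.mul_le_mul_left 2 (Finset.card_le_card ?_)) _)
  intro x hx
  rw [Finset.mem_filter] at hx ⊢
  exact ⟨hx.1, h x (Finset.mem_Ico.1 hx.1).2 hx.2⟩

theorem Majority.not_of_disjoint {p q : ℕ → Prop} {n : ℕ} (hp : Majority p n)
    (h : ∀ x, p x → ¬ q x) : ¬ Majority q n := by
  classical
  intro hq
  unfold Majority at hp hq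
  have hdisj : Disjoint ((Finset.Ico n ! (n + 1)!).filter p)
      ((Finset.Ico n ! (n + 1)!).filter q) :=
    Finset.disjoint_filter.2 fun x _ => h x
  have hcard := Finset.card_le_card (Finset.union_subset
    (Finset.filter_subset p (Finset.Ico n ! (n + 1)!))
    (Finset.filter_subset q (Finset.Ico n ! (n + 1)!)))
  rw [Finset.card_union_of_disjoint hdisj, Nat.card_Ico] at hcard
  have := Nat.factorial_le (Nat.le_succ n)
  rw [Nat.succ_eq_add_one] at this
  omega

theorem primrec_factorial : Primrec Nat.factorial := by
  have h : Primrec₂ fun n m : ℕ => (n + 1) * m :=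
    Primrec.nat_mul.comp (Primrec.succ.comp Primrec.fst) Primrec.snd
  refine (Primrec.nat_rec₁ 1 h).of_eq fun n => ?_
  induction n with
  | zero => rfl
  | succ n ih => rw [Nat.factorial_succ, ← ih]

theorem primrecRel_majority {β : Type*} [Primcodable β] {R : ℕ → β → Prop} (hR : PrimrecRel R) :
    PrimrecRel fun n b => Majority (fun x => R x b) n := by
  classical
  have hF : PrimrecRel fun (x : ℕ) (q : ℕ × β) => q.1 ! ≤ x ∧ R x q.2 :=
    (Primrec.nat_le.comp (primrec_factorial.comp (Primrec.fst.comp Primrec.snd)) Primrec.fst).and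
      (hR.comp Primrec.fst (Primrec.snd.comp Primrec.snd))
  have hs : Primrec fun q : ℕ × β => (q.1 + 1)! :=
    primrec_factorial.comp (Primrec.succ.comp Primrec.fst)
  have hc : Primrec fun q : ℕ × β =>
      ((List.range (q.1 + 1)!).filter fun x => q.1 ! ≤ x ∧ R x q.2).length :=
    Primrec.list_length.comp (hF.listFilter.comp (Primrec.list_range.comp hs) Primrec.id)
  refine (Primrec.nat_lt.comp hs (Primrec.nat_add.comp (primrec_factorial.comp Primrec.fst)
    (Primrec.nat_mul.comp (Primrec.const 2) hc))).of_eq fun q => ?_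
  have : ((List.range (q.1 + 1)!).filter fun x => q.1 ! ≤ x ∧ R x q.2).length =
      ((Finset.Ico q.1 ! (q.1 + 1)!).filter fun x => R x q.2).card := by
    change ((Finset.range (q.1 + 1)!).filter fun x => q.1 ! ≤ x ∧ R x q.2).card = _
    congr 1
    ext x
    simp only [Finset.mem_filter, Finset.mem_range, Finset.mem_Ico]
    tauto
  rw [this]
  change _ ↔ Majority (fun x => R x q.2) q.1
  unfold Majority
  convert Iff.rfl

/-! ### Decoding `codeI` and `codeH` -/

theorem eq_of_mem_Ico_factorial {m n x : ℕ} (hm : x ∈ Ico m ! (m + 1)!)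
    (hn : x ∈ Ico n ! (n + 1)!) : m = n := by
  rcases lt_trichotomy m n with h | h | h
  · exact absurd (hm.2.trans_le ((Nat.factorial_le h).trans hn.1)) (lt_irrefl x)
  · exact h
  · exact absurd (hn.2.trans_le ((Nat.factorial_le h).trans hm.1)) (lt_irrefl x)

theorem mem_codeI {A : Set ℕ} {x : ℕ} : x ∈ codeI A ↔ ∃ n ∈ A, x ∈ Ico n ! (n + 1)! := by
  simp only [codeI, mem_iUnion, exists_prop]

theorem mem_codeI_iff_of_mem_Ico {A : Set ℕ} {n x : ℕ} (hx : x ∈ Ico n ! (n + 1)!) :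
    x ∈ codeI A ↔ n ∈ A := by
  rw [mem_codeI]
  exact ⟨fun ⟨m, hm, h⟩ => eq_of_mem_Ico_factorial h hx ▸ hm, fun h => ⟨n, h, hx⟩⟩

theorem mem_codeH {A : Set ℕ} {n : ℕ} : n ∈ codeH A ↔ n.unpair.1 ∈ A := by
  constructor
  · rintro ⟨m, hm, i, rfl⟩
    simpa using hm
  · intro h
    exact ⟨_, h, n.unpair.2, (Nat.pair_unpair n).symm⟩

/-- A coarse description of `codeI B` decides `B` by majority vote, with finitely many errors. -/
theorem IsCoarseDescription.eventually_majority {D B : Set ℕ}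
    (h : IsCoarseDescription D (codeI B)) :
    ∀ᶠ n in atTop, Majority (fun x => x ∈ D ↔ n ∈ B) n := by
  classical
  have hfac : Tendsto (fun n : ℕ => (n + 1)!) atTop atTop :=
    tendsto_atTop_mono (fun n => (Nat.le_succ n).trans (Nat.self_le_factorial _)) tendsto_id
  -- For `n ≥ 1` the block fills at least half of `[0, (n+1)!)`, so errors numbering less than a
  -- quarter of `(n+1)!` are a minority in it.
  have hlim := (h.comp hfac).eventually (gt_mem_nhds (show (0 : ℝ) < 1 / 4 by norm_num))
  filter_upwards [hlim, eventually_ge_atTop 1] with n hn h1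
  have hpos : (0 : ℝ) < ((n + 1)! : ℕ) := by exact_mod_cast Nat.factorial_pos _
  rw [Function.comp_apply, div_lt_iff₀ hpos] at hn
  have hn' : 4 * (symmDiff D (codeI B) ∩ Iio (n + 1)!).ncard < (n + 1)! := by
    have : (4 : ℝ) * (symmDiff D (codeI B) ∩ Iio (n + 1)!).ncard < ((n + 1)! : ℕ) := by linarith
    exact_mod_cast this
  have hbad : ((Finset.Ico n ! (n + 1)!).filter fun x => ¬ (x ∈ D ↔ n ∈ B)).card ≤
      (symmDiff D (codeI B) ∩ Iio (n + 1)!).ncard := by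
    rw [← Set.ncard_coe_finset]
    refine Set.ncard_le_ncard ?_ ((Set.finite_Iio _).inter_of_right _)
    intro x hx
    obtain ⟨hx, hne⟩ := Finset.mem_filter.1 (Finset.mem_coe.1 hx)
    rw [Finset.mem_Ico] at hx
    refine ⟨?_, hx.2⟩
    rw [← mem_codeI_iff_of_mem_Ico (A := B) (x := x) hx] at hne
    rw [Set.mem_symmDiff]
    tauto
  have hsum := Finset.card_filter_add_card_filter_not (s := Finset.Ico n ! (n + 1)!)
    (fun x => x ∈ D ↔ n ∈ B)
  rw [Nat.card_Ico] at hsum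
  have hle : 2 * n ! ≤ (n + 1)! := by
    rw [Nat.factorial_succ]
    exact Nat.mul_le_mul_right _ (by omega)
  have hmaj : (n + 1)! < n ! +
      2 * ((Finset.Ico n ! (n + 1)!).filter fun x => x ∈ D ↔ n ∈ B).card := by
    omega
  unfold Majority
  convert hmaj

theorem isCoarseDescription_of_finite {D X : Set ℕ} (h : (symmDiff D X).Finite) :
    IsCoarseDescription D X := by
  refine squeeze_zero (fun n => by positivity) (fun n => ?_)
    (tendsto_const_div_atTop_nhds_zero_nat ((symmDiff D X).ncard : ℝ))
  gcongr
  exact Set.inter_subset_left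

theorem charSeq_eq_true {A : Set ℕ} {n : ℕ} : charSeq A n = true ↔ n ∈ A := by
  simp [charSeq]

/-! ### Nonuniform reducibility -/

theorem nonuniformlyCoarselyReducible_codeE_codeI (X : Set ℕ) :
    NonuniformlyCoarselyReducible (codeE X) (codeI X) := by
  classical
  intro D hD
  obtain ⟨k, hk⟩ := eventually_atTop.1 hD.eventually_majority
  have hmaj : ∀ m, k ≤ m → (Majority (· ∈ D) m ↔ m ∈ X) := by
    intro m hm
    by_cases hX : m ∈ X
    · simpa [hX] using hk m hm
    · simp only [hX, iff_false]
      exact (hk m hm).not_of_disjoint fun x hx hxD => hX (hx.1 hxD)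
  -- The finite table for the bits on which the vote may fail.
  let L : List ℕ := (List.range k).filter (· ∈ X)
  let Q : ℕ → ℕ × List Bool → Prop := fun n q => n ! ≤ q.1 ∧ q.1 < (n + 1)! ∧
    (n.unpair.1 ∈ L ∨ k ≤ n.unpair.1 ∧ Majority (fun y => q.2[y]? = some true) n.unpair.1)
  have hm : Primrec fun r : ℕ × ℕ × List Bool => r.1.unpair.1 :=
    Primrec.fst.comp (Primrec.unpair.comp Primrec.fst)
  have hq : Primrec fun r : ℕ × ℕ × List Bool => r.2.1 := Primrec.fst.comp Primrec.snd
  have hbit : PrimrecRel fun (y : ℕ) (ρ : List Bool) => ρ[y]? = some true :=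
    Primrec.eq.comp (Primrec.list_getElem?.comp Primrec.snd Primrec.fst) (Primrec.const _)
  have hL : PrimrecPred fun n : ℕ => n ∈ L := by
    have h : PrimrecRel fun (L : List ℕ) n => ∃ a ∈ L, a = n := Primrec.eq.exists_mem_list
    exact (h.comp (Primrec.const L) Primrec.id).of_eq fun n => by simp
  have hQ : PrimrecRel Q := by
    refine PrimrecPred.and (Primrec.nat_le.comp (primrec_factorial.comp Primrec.fst) hq)
      (PrimrecPred.and (Primrec.nat_lt.comp hq
        (primrec_factorial.comp (Primrec.succ.comp Primrec.fst)))
        (PrimrecPred.or (hL.comp hm) (PrimrecPred.and (Primrec.nat_le.comp (Primrec.const k) hm)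
          ?_)))
    exact (primrecRel_majority hbit).comp hm (Primrec.snd.comp Primrec.snd)
  have hF : Primrec₂ fun (x : ℕ) (ρ : List Bool) =>
      if ∃ n < x + 1, Q n (x, ρ) then 1 else 0 :=
    Primrec.ite ((primrecRel_exists_lt hQ).comp (Primrec.succ.comp Primrec.fst) Primrec.id)
      (Primrec.const 1) (Primrec.const 0)
  refine ⟨codeE X, ?_, isCoarseDescription_of_finite (by simp)⟩
  suffices h : charFun (codeE X) = fun x => Part.some
      (if ∃ n < x + 1, Q n (x, initSeg (charSeq D) (x + 1)!) then 1 else 0) by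
    rw [h]
    -- If `x` lies in block `n`, then `n.unpair.1 ≤ n ≤ x`, so the vote needed reads `D` only below
    -- `(x + 1)!`.
    exact turingReducible_of_primrec hF (primrec_factorial.comp Primrec.succ)
  funext x
  have hiff : x ∈ codeE X ↔
      ∃ n < x + 1, Q n (x, initSeg (charSeq D) (x + 1)!) := by
    rw [codeE, mem_codeI]
    have hX : ∀ n < x + 1, n ∈ codeH X ↔ (n.unpair.1 ∈ L ∨ k ≤ n.unpair.1 ∧
        Majority (fun y => (initSeg (charSeq D) (x + 1)!)[y]? = some true) n.unpair.1) := by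
      intro n hn
      have hD : Majority (fun y => (initSeg (charSeq D) (x + 1)!)[y]? = some true) n.unpair.1 ↔
          Majority (· ∈ D) n.unpair.1 := by
        have hb : ∀ y < (n.unpair.1 + 1)!,
            ((initSeg (charSeq D) (x + 1)!)[y]? = some true ↔ y ∈ D) := by
          intro y hy
          have : y < (x + 1)! := hy.trans_le (Nat.factorial_le
            (by have := Nat.unpair_left_le n; omega))
          rw [getElem?_initSeg, if_pos this, Option.some_inj, charSeq_eq_true]
        exact ⟨fun h => h.mono fun y hy => (hb y hy).1, fun h => h.mono fun y hy => (hb y hy).2⟩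
      rw [mem_codeH, hD]
      rcases lt_or_ge n.unpair.1 k with h | h
      · simp [L, h, h.not_ge]
      · simp [L, h, h.not_gt, hmaj _ h]
    constructor
    · rintro ⟨n, hn, hx⟩
      have hlt : n < x + 1 := Nat.lt_succ_of_le ((Nat.self_le_factorial n).trans hx.1)
      exact ⟨n, hlt, hx.1, hx.2, (hX n hlt).1 hn⟩
    · rintro ⟨n, hlt, h₁, h₂, h₃⟩
      exact ⟨n, (hX n hlt).2 h₃, h₁, h₂⟩
  simp only [charFun, ← hiff, charSeq]
  by_cases hx : x ∈ codeE X <;> simp [hx]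

/-! ### Uniform reducibility -/

open Classical in
/-- If `ρ` is an initial segment of a set `A`, then this is the initial segment of the same length
of `codeI {n ∈ A | N ≤ n}`. -/
noncomputable def codeStr (N : ℕ) (ρ : List Bool) : List Bool :=
  (List.range ρ.length).map fun k =>
    decide (∃ n < k + 1, N ≤ n ∧ n ! ≤ k ∧ k < (n + 1)! ∧ ρ[n]? = some true)

theorem primrec_codeStr : Primrec₂ codeStr := by
  classical
  have h : PrimrecRel fun (n : ℕ) (q : (ℕ × List Bool) × ℕ) =>
      q.1.1 ≤ n ∧ n ! ≤ q.2 ∧ q.2 < (n + 1)! ∧ q.1.2[n]? = some true := by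
    have hk : Primrec fun r : ℕ × (ℕ × List Bool) × ℕ => r.2.2 := Primrec.snd.comp Primrec.snd
    have hp : Primrec fun r : ℕ × (ℕ × List Bool) × ℕ => r.2.1 := Primrec.fst.comp Primrec.snd
    refine PrimrecPred.and (Primrec.nat_le.comp (Primrec.fst.comp hp) Primrec.fst)
      (PrimrecPred.and (Primrec.nat_le.comp (primrec_factorial.comp Primrec.fst) hk)
        (PrimrecPred.and (Primrec.nat_lt.comp hk
          (primrec_factorial.comp (Primrec.succ.comp Primrec.fst))) ?_))
    exact Primrec.eq.comp (Primrec.list_getElem?.comp (Primrec.snd.comp hp) Primrec.fst)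
      (Primrec.const _)
  have h' : Primrec₂ fun (p : ℕ × List Bool) (k : ℕ) =>
      decide (∃ n < k + 1, p.1 ≤ n ∧ n ! ≤ k ∧ k < (n + 1)! ∧ p.2[n]? = some true) :=
    primrecPred_iff_primrec_decide.1
      ((primrecRel_exists_lt h).comp (Primrec.succ.comp Primrec.snd) Primrec.id)
  exact Primrec.list_map (Primrec.list_range.comp (Primrec.list_length.comp Primrec.snd)) h'

/-- Since `n ≤ n!`, membership of `k < t` in the code depends only on bits with index at most `k`,
which the string contains. -/
theorem codeStr_initSeg (N t : ℕ) (Z : ℕ → Bool) :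
    codeStr N (initSeg Z t) = initSeg (charSeq (codeI {n | N ≤ n ∧ Z n = true})) t := by
  classical
  rw [codeStr, length_initSeg]
  refine List.map_congr_left fun k hk => ?_
  have hk := List.mem_range.1 hk
  rw [charSeq]
  congr 1
  rw [mem_codeI, eq_iff_iff]
  constructor
  · rintro ⟨n, hn, hN, h₁, h₂, h₃⟩
    rw [getElem?_initSeg, if_pos (by omega), Option.some_inj] at h₃
    exact ⟨n, ⟨hN, h₃⟩, h₁, h₂⟩
  · rintro ⟨n, ⟨hN, hZ⟩, h₁, h₂⟩
    have hn := (Nat.self_le_factorial n).trans h₁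
    refine ⟨n, by omega, hN, h₁, h₂, ?_⟩
    rw [getElem?_initSeg, if_pos (by omega), hZ]

/-- The computation from `codeStr N ρ` gives the value `v` on most of `[j!, (j+1)!)`. -/
def MajorityValue (c : OracleCode) (v : ℕ) (N : ℕ) (ρ : List Bool) (j : ℕ) : Prop :=
  Majority (fun x => c.evalStr (codeStr N ρ) x = some v) j

/-- The computation from `codeStr N ρ` predicts that the `m`-th row of the output belongs to
the computed set: this is the last majority vote in this row that has been decided. -/
def RowPrediction (c : OracleCode) (N : ℕ) (ρ : List Bool) (m : ℕ) : Prop :=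
  ∃ i < ρ.length, MajorityValue c 1 N ρ (Nat.pair m i) ∧
    ∀ i' < ρ.length, i ≤ i' → ¬ MajorityValue c 0 N ρ (Nat.pair m i')

/-- The first `N` entries of `ρ` are those predicted from the other entries. -/
def SelfPredicting (c : OracleCode) (N : ℕ) (ρ : List Bool) : Prop :=
  ∀ m < N, ρ[m]? = some true ↔ RowPrediction c N ρ m

theorem primrecRel_selfPredicting (c : OracleCode) : PrimrecRel (SelfPredicting c) := by
  classical
  have hval : ∀ v, PrimrecRel fun (j : ℕ) (q : ℕ × List Bool) => MajorityValue c v q.1 q.2 j := by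
    intro v
    have h : PrimrecRel fun (x : ℕ) (q : ℕ × List Bool) =>
        c.evalStr (codeStr q.1 q.2) x = some v :=
      Primrec.eq.comp (c.primrec_evalStr.comp (primrec_codeStr.comp
        (Primrec.fst.comp Primrec.snd) (Primrec.snd.comp Primrec.snd)) Primrec.fst)
        (Primrec.const _)
    exact primrecRel_majority h
  have hlater : PrimrecRel fun (i' : ℕ) (q : ℕ × ℕ × ℕ × List Bool) =>
      ¬ q.1 ≤ i' ∨ ¬ MajorityValue c 0 q.2.2.1 q.2.2.2 (Nat.pair q.2.1 i') :=
    PrimrecPred.or (PrimrecPred.not (Primrec.nat_le.comp (Primrec.fst.comp Primrec.snd)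
      Primrec.fst)) (PrimrecPred.not ((hval 0).comp (Primrec₂.natPair.comp
        (Primrec.fst.comp (Primrec.snd.comp Primrec.snd)) Primrec.fst)
        (Primrec.snd.comp (Primrec.snd.comp Primrec.snd))))
  have hlen : Primrec fun q : ℕ × ℕ × ℕ × List Bool => q.2.2.2.length :=
    Primrec.list_length.comp (Primrec.snd.comp (Primrec.snd.comp Primrec.snd))
  have hi : PrimrecRel fun (i : ℕ) (q : ℕ × ℕ × List Bool) =>
      MajorityValue c 1 q.2.1 q.2.2 (Nat.pair q.1 i) ∧
        ∀ i' < q.2.2.length, i ≤ i' → ¬ MajorityValue c 0 q.2.1 q.2.2 (Nat.pair q.1 i') := by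
    refine PrimrecPred.and ((hval 1).comp (Primrec₂.natPair.comp
      (Primrec.fst.comp Primrec.snd) Primrec.fst) (Primrec.snd.comp Primrec.snd)) ?_
    refine ((primrecRel_forall_lt hlater).comp hlen Primrec.id).of_eq fun q => ?_
    simp only [id, ← imp_iff_not_or]
  have hrow : PrimrecRel fun (m : ℕ) (q : ℕ × List Bool) => RowPrediction c q.1 q.2 m :=
    (primrecRel_exists_lt hi).comp
      (Primrec.list_length.comp (Primrec.snd.comp Primrec.snd)) Primrec.id
  have hbit : PrimrecRel fun (m : ℕ) (q : ℕ × List Bool) => q.2[m]? = some true :=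
    Primrec.eq.comp (Primrec.list_getElem?.comp (Primrec.snd.comp Primrec.snd) Primrec.fst)
      (Primrec.const _)
  have hiff : PrimrecRel fun (m : ℕ) (q : ℕ × List Bool) =>
      q.2[m]? = some true ↔ RowPrediction c q.1 q.2 m :=
    (PrimrecPred.and (hbit.not.or hrow) (hrow.not.or hbit)).of_eq fun q => by tauto
  exact (primrecRel_forall_lt hiff).comp Primrec.fst Primrec.id

/-- `codeStr N` ignores the first `N` bits, so equal tails give equal predictions; one stage that is
late enough for both sequences decides all these bits. -/
theorem eq_of_eventually_selfPredicting {c : OracleCode} {N : ℕ} {Z Z' : ℕ → Bool}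
    (h : ∀ n, N ≤ n → Z n = Z' n) (hZ : ∃ s, ∀ t, s ≤ t → SelfPredicting c N (initSeg Z t))
    (hZ' : ∃ s, ∀ t, s ≤ t → SelfPredicting c N (initSeg Z' t)) : Z = Z' := by
  obtain ⟨s, hs⟩ := hZ
  obtain ⟨s', hs'⟩ := hZ'
  funext m
  rcases le_or_gt N m with hm | hm
  · exact h m hm
  have hset : {n | N ≤ n ∧ Z n = true} = {n | N ≤ n ∧ Z' n = true} := by
    ext n
    exact and_congr_right fun hn => by rw [h n hn]
  let t := max (max s s') N
  have h₁ := hs t (by simp [t]) m hm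
  have h₂ := hs' t (by simp [t]) m hm
  have hmt : m < t := hm.trans_le (le_max_right _ _)
  have hrow : RowPrediction c N (initSeg Z t) m ↔ RowPrediction c N (initSeg Z' t) m := by
    simp only [RowPrediction, MajorityValue, codeStr_initSeg, length_initSeg, hset]
  rw [getElem?_initSeg, if_pos hmt, Option.some_inj] at h₁ h₂
  exact Bool.eq_iff_iff.2 (h₁.trans (hrow.trans h₂.symm))

/-- The true votes in row `m` equal `X m` from block `j` on. Votes seen at a finite stage are never
wrong about the output, so it suffices to wait until block `j` is decided in each of the rows below
`N`. -/
theorem eventually_selfPredicting {c : OracleCode} {X : Set ℕ}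
    (hc : ∀ D : Set ℕ, IsCoarseDescription D (codeI X) →
      ∃ Z : Set ℕ, c.eval (charFun D) = charFun Z ∧ IsCoarseDescription Z (codeE X)) (N : ℕ) :
    ∀ᶠ t in atTop, SelfPredicting c N (initSeg (charSeq X) t) := by
  classical
  set A := codeI {n | N ≤ n ∧ charSeq X n = true} with hA
  have hAX : IsCoarseDescription A (codeI X) := by
    refine isCoarseDescription_of_finite ((Set.finite_Iio (N + 1)!).subset fun x hx => ?_)
    by_contra hge
    have hiff : x ∈ A ↔ x ∈ codeI X := by
      rw [hA, mem_codeI, mem_codeI]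
      refine exists_congr fun n => ?_
      simp only [mem_ofPred_eq, charSeq_eq_true]
      constructor
      · exact fun h => ⟨h.1.2, h.2⟩
      · refine fun h => ⟨⟨?_, h.1⟩, h.2⟩
        by_contra hn
        exact hge (h.2.2.trans_le (Nat.factorial_le (by omega)))
    rw [Set.mem_symmDiff, hiff] at hx
    tauto
  obtain ⟨W, hW, hWE⟩ := hc A hAX
  obtain ⟨j, hj⟩ := eventually_atTop.1 (IsCoarseDescription.eventually_majority hWE)
  have hsound : ∀ {t x y}, c.evalStr (initSeg (charSeq A) t) x = some y →
      y = (charSeq W x).toNat := by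
    intro t x y h
    have hy : y ∈ c.eval (charFun A) x := c.evalStr_sound (charSeq A) h
    rw [hW] at hy
    exact Part.mem_some_iff.1 hy
  have hval : ∀ x, ∀ᶠ t in atTop,
      c.evalStr (initSeg (charSeq A) t) x = some (charSeq W x).toNat := fun x => by
    obtain ⟨s, hs⟩ := c.exists_evalStr (charSeq A)
      ((congrFun hW x).symm ▸ Part.mem_some (charSeq W x).toNat :
        (charSeq W x).toNat ∈ c.eval (charFun A) x)
    exact eventually_atTop.2 ⟨s, fun t ht => c.evalStr_mono _ ht hs⟩
  have hblock : ∀ᶠ t in atTop, ∀ m ∈ Finset.range N,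
      ∀ x ∈ Finset.range (Nat.pair m j + 1)!,
        c.evalStr (initSeg (charSeq A) t) x = some (charSeq W x).toNat := by
    rw [Filter.eventually_all_finset]
    intro m _
    rw [Filter.eventually_all_finset]
    exact fun x _ => hval x
  filter_upwards [hblock, eventually_gt_atTop (max N j)] with t ht htN m hm
  have hmt : m < t := hm.trans ((le_max_left _ _).trans_lt htN)
  have hjt : j < t := (le_max_right _ _).trans_lt htN
  have hrow : ∀ i, j ≤ i → Majority (fun x => x ∈ W ↔ m ∈ X) (Nat.pair m i) := by
    intro i hi
    -- One threshold `j` serves every row, because `i ≤ ⟨m, i⟩`.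
    have := hj (Nat.pair m i) (hi.trans (Nat.right_le_pair m i))
    simpa only [mem_codeH, Nat.unpair_pair] using this
  have hone : ∀ {i}, MajorityValue c 1 N (initSeg (charSeq X) t) i → Majority (· ∈ W) i :=
    fun h => h.mono fun x _ hx => by
      rw [codeStr_initSeg] at hx
      have := hsound hx
      rw [← charSeq_eq_true]
      cases hb : charSeq W x <;> simp [hb] at this ⊢
  have hzero : ∀ {i}, MajorityValue c 0 N (initSeg (charSeq X) t) i → Majority (· ∉ W) i :=
    fun h => h.mono fun x _ hx => by
      rw [codeStr_initSeg] at hx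
      have := hsound hx
      rw [← charSeq_eq_true]
      cases hb : charSeq W x <;> simp [hb] at this ⊢
  rw [getElem?_initSeg, if_pos hmt, Option.some_inj, charSeq_eq_true]
  constructor
  · intro hX
    simp only [hX, iff_true] at hrow
    refine ⟨j, by simpa using hjt, (hrow j le_rfl).mono fun x hx hxW => ?_, fun i _ hi h0 => ?_⟩
    · rw [codeStr_initSeg, ← hA, ht m (Finset.mem_range.2 hm) x (Finset.mem_range.2 hx),
        charSeq_eq_true.2 hxW]
      rfl
    · exact (hrow i hi).not_of_disjoint (fun x hx hx' => hx' hx) (hzero h0)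
  · rintro ⟨i, hi, h1, h0⟩
    by_contra hX
    simp only [hX, iff_false] at hrow
    rcases le_or_gt j i with hji | hij
    · exact (hrow i hji).not_of_disjoint (fun x hx hx' => hx hx') (hone h1)
    -- A misleading early vote at `i < j` is overruled by the vote `0` at block `j`.
    · refine h0 j (by simpa using hjt) hij.le ((hrow j le_rfl).mono fun x hx hxW => ?_)
      have hb : charSeq W x = false := by simp [charSeq, hxW]
      rw [codeStr_initSeg, ← hA, ht m (Finset.mem_range.2 hm) x (Finset.mem_range.2 hx), hb]
      rfl

end CoarseReducibility

theorem mainTheorem12 (X : Set ℕ) (hX : CoarseReducibility.IsTwoRandom X) :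
    CoarseReducibility.NonuniformlyCoarselyReducible
        (CoarseReducibility.codeE X) (CoarseReducibility.codeI X) ∧
      ¬ CoarseReducibility.UniformlyCoarselyReducible
        (CoarseReducibility.codeE X) (CoarseReducibility.codeI X) := by
  refine ⟨CoarseReducibility.nonuniformlyCoarselyReducible_codeE_codeI X, ?_⟩
  rintro ⟨c, hc⟩
  exact CoarseReducibility.not_isTwoRandom_of_eventually
    (CoarseReducibility.primrecRel_selfPredicting c)
    (fun _ _ _ => CoarseReducibility.eq_of_eventually_selfPredicting)
    (fun N => Filter.eventually_atTop.1 (CoarseReducibility.eventually_selfPredicting hc N)) hX
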